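/- Let $N,K$ and $M_1,\dots,M_K$ be nonnegative integers, let $X_k,Y_k\in\mathbb R^{N\times M_k}$ ($k=1,\dots,K$) and $\bar S\in\mathbb R^{N\times N}$, let $\mathcal S\subseteq\mathbb R^{N\times N}$ be closed and convex, and let $\alpha_1,\dots,\alpha_K,\lambda,\beta,\gamma,\delta_1,\delta_2>0$. With $r_\delta(Z)=\sum_{i,j}\log(|Z_{ij}|+\delta)$, put $$f(\{H_k\},S)=\sum_{k=1}^K\alpha_k\|Y_k-H_kX_k\|_F^2+\lambda r_{\delta_1}(S-\bar S)+\beta r_{\delta_2}(S)+\sum_{k=1}^K\gamma\|SH_k-H_kS\|_F^2$$ for $H_k\in\mathbb R^{N\times N}$, $S\in\mathcal S$. From an arbitrary starting point, let $(\{H_k^{(t)}\},S^{(t)})_{t\ge 0}$ satisfy, for every $t\ge 0$ and every $k$, $$H_k^{(t+1)}\in\arg\min_{H\in\mathbb R^{N\times N}}\ \alpha_k\|Y_k-HX_k\|_F^2+\gamma\|S^{(t)}H-HS^{(t)}\|_F^2,$$ $$S^{(t+1)}\in\arg\min_{S\in\mathcal S}\ \sum_{i,j}\left(\frac{\lambda\,|S_{ij}-\bar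 S_{ij}|}{|S^{(t)}_{ij}-\bar S_{ij}|+\delta_1}+\frac{\beta\,|S_{ij}|}{|S^{(t)}_{ij}|+\delta_2}\right)+\sum_{k=1}^K\gamma\|SH_k^{(t+1)}-H_k^{(t+1)}S\|_F^2 .$$ Say that $X$ excites all graph frequencies of $S$ if $w^\top X\neq 0$ for every left eigenvector $w\in\mathbb C^N\setminus\{0\}$ of $S$; when $S=V\,\mathrm{diag}(\mu)V^{-1}$ has no repeated eigenvalues, this means that every row of $V^{-1}X$ has a nonzero entry. Assume that every $X_k$ excites all graph frequencies of every $S$ in the closure of $\{S^{(t)}:t\ge 0\}$. Let $z^{(t)}=[\mathrm{vec}(H_1^{(t)})^\top,\dots,\mathrm{vec}(H_K^{(t)})^\top,\mathrm{vec}(S^{(t)})^\top]^\top$, and let $\mathcal Z^*$ be the set of stationary points of $\min f$ subject to $S\in\mathcal S$, that is, of the feasible points at which the directional derivative of $f$ towards every feasible point exists and is nonnegative. Then $z^{(t)}$ converges to the set of stationary points: the minimum $\mathsf d(z^{(t)}\,|\,\mathcal Z^*):=\min_{z^*\in\mathcal Z^*}\|z^{(t)}-z^*\|_2$ is attained for every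 $t$ (in particular $\mathcal Z^*\neq\emptyset$), and $\lim_{t\to\infty}\mathsf d(z^{(t)}\,|\,\mathcal Z^*)=0$. -/

import Mathlib

open Filter Topology

noncomputable section

namespace JointGF

/-- Squared Frobenius norm of a real matrix. -/
def frobSq {m n : ℕ} (A : Matrix (Fin m) (Fin n) ℝ) : ℝ :=
  ∑ i, ∑ j, (A i j) ^ 2

/-- The logarithmic sparsity penalty `r_δ(Z) = ∑ᵢⱼ log (|Zᵢⱼ| + δ)`. -/
def logPenalty {N : ℕ} (δ : ℝ) (Z : Matrix (Fin N) (Fin N) ℝ) : ℝ :=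
  ∑ i, ∑ j, Real.log (|Z i j| + δ)

/-- The optimization variables `({H_k}, S)`. -/
abbrev Vars (N K : ℕ) : Type :=
  (Fin K → Matrix (Fin N) (Fin N) ℝ) × Matrix (Fin N) (Fin N) ℝ

/-- The joint objective `f({H_k}, S)`. -/
def objective {N K : ℕ} {M : Fin K → ℕ}
    (X Y : (k : Fin K) → Matrix (Fin N) (Fin (M k)) ℝ) (Sbar : Matrix (Fin N) (Fin N) ℝ)
    (α : Fin K → ℝ) (lam β γ δ₁ δ₂ : ℝ) (z : Vars N K) : ℝ :=
  (∑ k, α k * frobSq (Y k - z.1 k * X k)) + lam * logPenalty δ₁ (z.2 - Sbar)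
    + β * logPenalty δ₂ z.2 + ∑ k, γ * frobSq (z.2 * z.1 k - z.1 k * z.2)

/-- Cost of the filter identification step for one filter `H`, with the GSO `S` fixed. -/
def filterCost {N m : ℕ} (X Y : Matrix (Fin N) (Fin m) ℝ) (a γ : ℝ)
    (S H : Matrix (Fin N) (Fin N) ℝ) : ℝ :=
  a * frobSq (Y - H * X) + γ * frobSq (S * H - H * S)

/-- Cost of the graph denoising step: `S₀` is the previous GSO, which determines the weights
`1 / (|S₀ᵢⱼ - Sbarᵢⱼ| + δ₁)` and `1 / (|S₀ᵢⱼ| + δ₂)` of the two `ℓ₁` terms; `H` holds the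
current filters; `S` is the variable. -/
def graphCost {N K : ℕ} (Sbar : Matrix (Fin N) (Fin N) ℝ) (lam β γ δ₁ δ₂ : ℝ)
    (S₀ : Matrix (Fin N) (Fin N) ℝ) (H : Fin K → Matrix (Fin N) (Fin N) ℝ)
    (S : Matrix (Fin N) (Fin N) ℝ) : ℝ :=
  (∑ i, ∑ j, (lam * (1 / (|S₀ i j - Sbar i j| + δ₁)) * |S i j - Sbar i j|
      + β * (1 / (|S₀ i j| + δ₂)) * |S i j|))
    + ∑ k, γ * frobSq (S * H k - H k * S)

/-- `z t = ({H_k^(t)}, S^(t))` is a run of the alternating algorithm over the family `𝒮` of GSOs.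
The initial point is arbitrary; at every iteration each filter is a minimizer of its filter
identification cost, and then the GSO is a minimizer over `𝒮` of the graph denoising cost. -/
structure IsRun {N K : ℕ} {M : Fin K → ℕ}
    (X Y : (k : Fin K) → Matrix (Fin N) (Fin (M k)) ℝ) (Sbar : Matrix (Fin N) (Fin N) ℝ)
    (𝒮 : Set (Matrix (Fin N) (Fin N) ℝ)) (α : Fin K → ℝ) (lam β γ δ₁ δ₂ : ℝ)
    (z : ℕ → Vars N K) : Prop where
  filter_step : ∀ t k, IsMinOn (filterCost (X k) (Y k) (α k) γ (z t).2) Set.univ ((z (t + 1)).1 k)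
  graph_mem : ∀ t, (z (t + 1)).2 ∈ 𝒮
  graph_step : ∀ t,
    IsMinOn (graphCost Sbar lam β γ δ₁ δ₂ (z t).2 (z (t + 1)).1) 𝒮 (z (t + 1)).2

/-- `X` excites all graph frequencies of the GSO `S`: no left eigenvector of `S` (real or
complex) annihilates `X`. The left eigenvectors are the rows of the graph Fourier transforms
`V⁻¹` of `S = V diag(μ) V⁻¹`; for a GSO without repeated eigenvalues the condition says that
every row of `V⁻¹ X` has a nonzero entry, see `excitesAllFrequencies_iff`. -/
def ExcitesAllFrequencies {N m : ℕ} (S : Matrix (Fin N) (Fin N) ℝ)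
    (X : Matrix (Fin N) (Fin m) ℝ) : Prop :=
  ∀ (μ : ℂ) (w : Fin N → ℂ), w ≠ 0 →
    Matrix.vecMul w (S.map Complex.ofReal) = μ • w →
    Matrix.vecMul w (X.map Complex.ofReal) ≠ 0

/-- For a diagonalizable GSO without repeated eigenvalues, all graph frequencies are excited if
and only if every row of the graph Fourier transform `V⁻¹ X` has a nonzero entry. -/
theorem excitesAllFrequencies_iff {N m : ℕ} (S : Matrix (Fin N) (Fin N) ℝ)
    (X : Matrix (Fin N) (Fin m) ℝ) (V : Matrix (Fin N) (Fin N) ℂ) (hV : IsUnit V.det)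
    (μ : Fin N → ℂ) (hμ : Function.Injective μ)
    (hS : S.map Complex.ofReal = V * Matrix.diagonal μ * V⁻¹) :
    ExcitesAllFrequencies S X ↔ ∀ i, ∃ j, (V⁻¹ * X.map Complex.ofReal) i j ≠ 0 := by
  have hVV : V * V⁻¹ = 1 := Matrix.mul_nonsing_inv V hV
  have hVV' : V⁻¹ * V = 1 := Matrix.nonsing_inv_mul V hV
  constructor
  · intro h i
    have hrow : ∀ {p : ℕ} (B : Matrix (Fin N) (Fin p) ℂ),
        Matrix.vecMul (V⁻¹ i) B = (V⁻¹ * B) i := by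
      intro p B
      ext j
      simp [Matrix.vecMul, dotProduct, Matrix.mul_apply]
    have hne : V⁻¹ i ≠ 0 := by
      intro h0
      have h1 := hrow V
      rw [h0, hVV', Matrix.zero_vecMul] at h1
      have := congrFun h1 i
      simp at this
    have hw : Matrix.vecMul (V⁻¹ i) (S.map Complex.ofReal) = μ i • (V⁻¹ i) := by
      rw [hrow, hS, Matrix.mul_assoc, ← Matrix.mul_assoc, hVV', Matrix.one_mul]
      ext j
      simp [Matrix.diagonal_mul]
    have := h (μ i) _ hne hw
    rw [hrow] at this
    by_contra! hc
    exact this (funext hc)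
  · intro h ν w hw hwS hX
    set c : Fin N → ℂ := Matrix.vecMul w V with hc
    have hwc : w = Matrix.vecMul c V⁻¹ := by
      rw [hc, Matrix.vecMul_vecMul, hVV, Matrix.vecMul_one]
    have hcd : Matrix.vecMul c (Matrix.diagonal μ) = ν • c := by
      have h1 : Matrix.vecMul (Matrix.vecMul w (S.map Complex.ofReal)) V
          = Matrix.vecMul c (Matrix.diagonal μ) := by
        rw [hS, Matrix.vecMul_vecMul, Matrix.mul_assoc, hVV', Matrix.mul_one,
          ← Matrix.vecMul_vecMul]
      rw [← h1, hwS, Matrix.smul_vecMul]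
    have hc0 : c ≠ 0 := by
      intro h0
      exact hw (by rw [hwc, h0, Matrix.zero_vecMul])
    have hcj : ∀ j, c j * μ j = ν * c j := by
      intro j
      have := congrFun hcd j
      simpa [Matrix.vecMul_diagonal] using this
    obtain ⟨i, hi⟩ := Function.ne_iff.mp hc0
    have hi : c i ≠ 0 := hi
    have hν : μ i = ν := by
      have := hcj i
      rw [mul_comm] at this
      exact mul_right_cancel₀ hi this
    have hz : ∀ j, j ≠ i → c j = 0 := by
      intro j hj
      by_contra hcj0
      have := hcj j
      rw [mul_comm] at this
      exact hj (hμ ((mul_right_cancel₀ hcj0 this).trans hν.symm))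
    obtain ⟨j, hj⟩ := h i
    rw [hwc, Matrix.vecMul_vecMul] at hX
    have hX' := congrFun hX j
    simp only [Matrix.vecMul, dotProduct, Pi.zero_apply] at hX'
    rw [Finset.sum_eq_single i (fun b _ hb => by rw [hz b hb, zero_mul]) (by simp)] at hX'
    exact (mul_ne_zero hi hj) hX'

/-- `z` is a stationary point of the problem `min_{y ∈ C} g y` (`C` convex): it is feasible, and
the directional derivative of `g` at `z` in every feasible direction `y - z`, `y ∈ C`, is
nonnegative. -/
def IsStationaryPoint {E : Type*} [AddCommGroup E] [Module ℝ E] (g : E → ℝ) (C : Set E)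
    (z : E) : Prop :=
  z ∈ C ∧ ∀ y ∈ C, ∃ L : ℝ, 0 ≤ L ∧
    HasDerivWithinAt (fun τ : ℝ => g (z + τ • (y - z))) L (Set.Ici 0) 0

/-- The stacked vector `[vec(H_1); …; vec(H_K); vec(S)]`, in Euclidean space. -/
def stack {N K : ℕ} (z : Vars N K) :
    EuclideanSpace ℝ ((Fin K × Fin N × Fin N) ⊕ (Fin N × Fin N)) :=
  WithLp.toLp 2 (Sum.elim (fun p => z.1 p.1 p.2.1 p.2.2) (fun p => z.2 p.1 p.2))

/-- The set of stationary points of the joint problem (`S ∈ 𝒮`, filters unconstrained), as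
stacked vectors. -/
def stationarySet {N K : ℕ} {M : Fin K → ℕ}
    (X Y : (k : Fin K) → Matrix (Fin N) (Fin (M k)) ℝ) (Sbar : Matrix (Fin N) (Fin N) ℝ)
    (𝒮 : Set (Matrix (Fin N) (Fin N) ℝ)) (α : Fin K → ℝ) (lam β γ δ₁ δ₂ : ℝ) :
    Set (EuclideanSpace ℝ ((Fin K × Fin N × Fin N) ⊕ (Fin N × Fin N))) :=
  stack '' {z : Vars N K |
    IsStationaryPoint (objective X Y Sbar α lam β γ δ₁ δ₂) {y : Vars N K | y.2 ∈ 𝒮} z}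

end JointGF

end

/-!
The argument rests on identifying the stationary points with the fixed points of the algorithm
(`isStationaryPoint_iff`): at a point `z`, the objective has the same one-sided directional
derivatives as the sum of the filter identification costs and the graph denoising cost built from
`z`. The weights of the `ℓ₁` terms are the slopes of the logarithms, and the commutator is bilinear,
so that moving both blocks contributes only at second order. As these costs are convex along lines,
a nonnegative directional derivative means minimality. The costs depend continuously on `z`, so the
set of fixed points is closed (`isClosed_isBlockMin`).

By concavity of the logarithm, the graph denoising cost majorizes the objective up to a constant
(`objective_sub_le_graphCost_sub`), so the objective decreases along the run once the GSO is
feasible, and it converges. The logarithmic penalty is coercive, which bounds the GSOs. The filters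
are bounded because the quadratic form `a ‖D X‖² + γ ‖S D - D S‖²` is uniformly coercive on the
closure of the GSOs (`exists_coercive`): a filter commuting with `S` has an `S`-invariant row space,
which contains a left eigenvector of `S` unless the filter vanishes, and excitation forbids that this
eigenvector annihilates `X`.

Finally, let consecutive iterates converge along a subsequence to `(H, S)` and `(H', S')`. Both
limits have the same objective value, so neither of the two half steps from `(H, S)` decreases the
objective; uniqueness of the minimizing filters gives `H = H'`, and then `S` minimizes its own
graph denoising cost (`IsRun.isBlockMin_of_tendsto`). So all cluster points of the bounded run are
stationary, which gives the convergence of the distances.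
-/

noncomputable section

namespace JointGF

variable {N K : ℕ} {M : Fin K → ℕ}

/-! ### The Frobenius norm -/

lemma frobSq_nonneg {m n : ℕ} (A : Matrix (Fin m) (Fin n) ℝ) : 0 ≤ frobSq A :=
  Finset.sum_nonneg fun _ _ => Finset.sum_nonneg fun _ _ => sq_nonneg _

lemma sq_apply_le_frobSq {m n : ℕ} (A : Matrix (Fin m) (Fin n) ℝ) (i : Fin m) (j : Fin n) :
    A i j ^ 2 ≤ frobSq A :=
  (Finset.single_le_sum (f := fun j => A i j ^ 2) (fun _ _ => sq_nonneg _)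
    (Finset.mem_univ j)).trans
    (Finset.single_le_sum (f := fun i => ∑ j, A i j ^ 2)
      (fun _ _ => Finset.sum_nonneg fun _ _ => sq_nonneg _) (Finset.mem_univ i))

lemma frobSq_eq_zero {m n : ℕ} {A : Matrix (Fin m) (Fin n) ℝ} : frobSq A = 0 ↔ A = 0 := by
  refine ⟨fun h => ?_, fun h => by simp [h, frobSq]⟩
  ext i j
  have := sq_apply_le_frobSq A i j
  rw [h] at this
  exact pow_eq_zero_iff two_ne_zero |>.1 (le_antisymm this (sq_nonneg _))

lemma frobSq_smul {m n : ℕ} (c : ℝ) (A : Matrix (Fin m) (Fin n) ℝ) :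
    frobSq (c • A) = c ^ 2 * frobSq A := by
  simp [frobSq, Finset.mul_sum, mul_pow]

lemma continuous_frobSq {m n : ℕ} :
    Continuous (frobSq : Matrix (Fin m) (Fin n) ℝ → ℝ) := by
  unfold frobSq
  fun_prop

/-! ### Excitation and coercivity of the filter identification step -/

/-- The row space of a filter that commutes with `S` is invariant under right multiplication by
`S`, so over `ℂ` it contains a left eigenvector of `S` unless it is zero. Hence a filter that
commutes with `S` and annihilates an exciting `X` vanishes. -/
lemma ExcitesAllFrequencies.eq_zero {m : ℕ} {S : Matrix (Fin N) (Fin N) ℝ}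
    {X : Matrix (Fin N) (Fin m) ℝ} (h : ExcitesAllFrequencies S X)
    {H : Matrix (Fin N) (Fin N) ℝ} (hX : H * X = 0) (hS : S * H = H * S) : H = 0 := by
  by_contra hne
  set Hc : Matrix (Fin N) (Fin N) ℂ := H.map Complex.ofReal with hHc
  set Sc : Matrix (Fin N) (Fin N) ℂ := S.map Complex.ofReal with hSc
  have hXc : Hc * X.map Complex.ofReal = 0 := by
    have := congrArg (fun A => A.map Complex.ofRealHom) hX
    simp only [Matrix.map_mul, Matrix.map_zero _ (map_zero Complex.ofRealHom)] at this
    exact this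
  have hcomm : Sc * Hc = Hc * Sc := by
    have := congrArg (fun A => A.map Complex.ofRealHom) hS
    simp only [Matrix.map_mul] at this
    exact this
  set W : Submodule ℂ (Fin N → ℂ) := LinearMap.range (Matrix.vecMulLinear Hc) with hW
  have hinv : ∀ w ∈ W, Matrix.vecMulLinear Sc w ∈ W := by
    rintro _ ⟨v, rfl⟩
    refine ⟨Matrix.vecMul v Sc, ?_⟩
    simp [Matrix.vecMul_vecMul, hcomm]
  obtain ⟨i, j, hij⟩ : ∃ i j, H i j ≠ 0 := by
    by_contra! hc
    exact hne (Matrix.ext hc)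
  have : Nontrivial W := by
    refine ⟨⟨⟨_, ⟨Pi.single i 1, rfl⟩⟩, 0, fun h0 => hij ?_⟩⟩
    have := congrFun (congrArg Subtype.val h0) j
    simpa [hHc] using this
  obtain ⟨μ, hμ⟩ := Module.End.exists_eigenvalue ((Matrix.vecMulLinear Sc).restrict hinv)
  obtain ⟨⟨w, v, hv⟩, hw⟩ := hμ.exists_hasEigenvector
  refine h μ w (fun h0 => hw.2 (Subtype.ext h0)) (congrArg Subtype.val hw.apply_eq_smul) ?_
  rw [← hv, Matrix.vecMulLinear_apply, Matrix.vecMul_vecMul, hXc, Matrix.vecMul_zero]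

/-- The quadratic form of the filter identification step, the exact second-order part of
`filterCost`. -/
def filterForm {m : ℕ} (X : Matrix (Fin N) (Fin m) ℝ) (a γ : ℝ)
    (S D : Matrix (Fin N) (Fin N) ℝ) : ℝ :=
  a * frobSq (D * X) + γ * frobSq (S * D - D * S)

lemma filterForm_nonneg {m : ℕ} (X : Matrix (Fin N) (Fin m) ℝ) {a γ : ℝ} (ha : 0 < a)
    (hγ : 0 < γ) (S D : Matrix (Fin N) (Fin N) ℝ) : 0 ≤ filterForm X a γ S D :=
  add_nonneg (mul_nonneg ha.le (frobSq_nonneg _)) (mul_nonneg hγ.le (frobSq_nonneg _))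

lemma filterForm_pos {m : ℕ} {X : Matrix (Fin N) (Fin m) ℝ} {a γ : ℝ} (ha : 0 < a) (hγ : 0 < γ)
    {S : Matrix (Fin N) (Fin N) ℝ} (h : ExcitesAllFrequencies S X)
    {D : Matrix (Fin N) (Fin N) ℝ} (hD : D ≠ 0) : 0 < filterForm X a γ S D := by
  refine (filterForm_nonneg X ha hγ S D).lt_of_ne fun h0 => hD ?_
  have h1 := mul_nonneg ha.le (frobSq_nonneg (D * X))
  have h2 := mul_nonneg hγ.le (frobSq_nonneg (S * D - D * S))
  unfold filterForm at h0
  have e1 : a * frobSq (D * X) = 0 := by linarith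
  have e2 : γ * frobSq (S * D - D * S) = 0 := by linarith
  refine h.eq_zero (frobSq_eq_zero.1 ?_) (sub_eq_zero.1 (frobSq_eq_zero.1 ?_))
  · exact (mul_eq_zero.1 e1).resolve_left ha.ne'
  · exact (mul_eq_zero.1 e2).resolve_left hγ.ne'

lemma filterCost_line {m : ℕ} (X Y : Matrix (Fin N) (Fin m) ℝ) (a γ : ℝ)
    (S H D : Matrix (Fin N) (Fin N) ℝ) (τ : ℝ) :
    filterCost X Y a γ S (H + τ • D) = a * frobSq (Y - H * X + τ • (-(D * X)))
      + γ * frobSq (S * H - H * S + τ • (S * D - D * S)) := by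
  have e₁ : Y - (H + τ • D) * X = Y - H * X + τ • (-(D * X)) := by
    rw [Matrix.add_mul, Matrix.smul_mul, smul_neg]; abel
  have e₂ : S * (H + τ • D) - (H + τ • D) * S
      = S * H - H * S + τ • (S * D - D * S) := by
    rw [Matrix.add_mul, Matrix.mul_add, Matrix.smul_mul, Matrix.mul_smul, smul_sub]; abel
  rw [filterCost, e₁, e₂]

/-- At a minimizer the linear part of the filter cost vanishes, so the excess cost is exactly the
quadratic form of the displacement. -/
lemma filterCost_eq_of_isMinOn {m : ℕ} {X Y : Matrix (Fin N) (Fin m) ℝ} {a γ : ℝ}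
    {S H : Matrix (Fin N) (Fin N) ℝ} (h : IsMinOn (filterCost X Y a γ S) Set.univ H)
    (G : Matrix (Fin N) (Fin N) ℝ) :
    filterCost X Y a γ S G = filterCost X Y a γ S H + filterForm X a γ S (G - H) := by
  have hfrob : ∀ {p : ℕ} (A B : Matrix (Fin N) (Fin p) ℝ), ∃ l : ℝ, ∀ τ : ℝ,
      frobSq (A + τ • B) = frobSq A + τ * l + τ ^ 2 * frobSq B := by
    intro p A B
    refine ⟨∑ i, ∑ j, 2 * A i j * B i j, fun τ => ?_⟩
    simp only [frobSq, Finset.mul_sum, ← Finset.sum_add_distrib]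
    refine Finset.sum_congr rfl fun i _ => Finset.sum_congr rfl fun j _ => ?_
    simp
    ring
  obtain ⟨l₁, h₁⟩ := hfrob (Y - H * X) (-((G - H) * X))
  obtain ⟨l₂, h₂⟩ := hfrob (S * H - H * S) (S * (G - H) - (G - H) * S)
  have hneg : frobSq (-((G - H) * X)) = frobSq ((G - H) * X) := by simp [frobSq]
  have key : ∀ τ : ℝ, filterCost X Y a γ S (H + τ • (G - H)) = filterCost X Y a γ S H
      + τ * (a * l₁ + γ * l₂) + τ ^ 2 * filterForm X a γ S (G - H) := by
    intro τ
    rw [filterCost_line, h₁, h₂, hneg]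
    unfold filterCost filterForm
    ring
  have hd : HasDerivAt (fun τ : ℝ => filterCost X Y a γ S (H + τ • (G - H)))
      (a * l₁ + γ * l₂) 0 := by
    have := (((hasDerivAt_id' (0 : ℝ)).mul_const (a * l₁ + γ * l₂)).const_add
      (filterCost X Y a γ S H)).fun_add
      (((hasDerivAt_id' (0 : ℝ)).fun_pow 2).mul_const (filterForm X a γ S (G - H)))
    simp only [key]
    simpa using this
  have hmin : IsLocalMin (fun τ : ℝ => filterCost X Y a γ S (H + τ • (G - H))) 0 :=
    Eventually.of_forall fun τ => by simpa using h (Set.mem_univ (H + τ • (G - H)))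
  have := key 1
  rw [hmin.hasDerivAt_eq_zero hd] at this
  simpa using this

lemma continuous_filterForm {m : ℕ} (X : Matrix (Fin N) (Fin m) ℝ) (a γ : ℝ) :
    Continuous fun p : Matrix (Fin N) (Fin N) ℝ × Matrix (Fin N) (Fin N) ℝ =>
      filterForm X a γ p.1 p.2 := by
  have := @continuous_frobSq
  unfold filterForm
  fun_prop

/-- The matrices with entries in `[-R, R]`. -/
def box (N : ℕ) (R : ℝ) : Set (Matrix (Fin N) (Fin N) ℝ) := {A | ∀ i j, |A i j| ≤ R}

lemma isCompact_box (N : ℕ) (R : ℝ) : IsCompact (box N R) := by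
  have h : IsCompact (Set.univ.pi fun _ : Fin N => Set.univ.pi fun _ : Fin N => Set.Icc (-R) R) :=
    isCompact_univ_pi fun _ => isCompact_univ_pi fun _ => isCompact_Icc
  have e : box N R
      = Set.univ.pi fun _ : Fin N => Set.univ.pi fun _ : Fin N => Set.Icc (-R) R :=
    Set.ext fun _ =>
      ⟨fun hA i _ j _ => abs_le.1 (hA i j), fun hA i j => abs_le.2 (hA i trivial j trivial)⟩
  rw [e]
  exact h

lemma mem_box_of_frobSq_le {A : Matrix (Fin N) (Fin N) ℝ} {C : ℝ} (h : frobSq A ≤ C) :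
    A ∈ box N (Real.sqrt C) := fun i j =>
  Real.abs_le_sqrt ((sq_apply_le_frobSq A i j).trans h)

/-- Excitation at every point of a compact set makes the filter quadratic form uniformly
coercive, by compactness of the unit sphere and homogeneity. -/
lemma exists_coercive {m : ℕ} {X : Matrix (Fin N) (Fin m) ℝ} {a γ : ℝ} (ha : 0 < a) (hγ : 0 < γ)
    {𝒦 : Set (Matrix (Fin N) (Fin N) ℝ)} (h𝒦 : IsCompact 𝒦)
    (hexc : ∀ S ∈ 𝒦, ExcitesAllFrequencies S X) :
    ∃ c > 0, ∀ S ∈ 𝒦, ∀ D, c * frobSq D ≤ filterForm X a γ S D := by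
  have hsph : IsCompact {D : Matrix (Fin N) (Fin N) ℝ | frobSq D = 1} :=
    (isCompact_box N _).of_isClosed_subset (isClosed_eq continuous_frobSq continuous_const)
      fun D (hD : frobSq D = 1) => mem_box_of_frobSq_le hD.le
  have hpos : ∀ p ∈ 𝒦 ×ˢ {D : Matrix (Fin N) (Fin N) ℝ | frobSq D = 1},
      0 < filterForm X a γ p.1 p.2 := by
    rintro ⟨S, D⟩ ⟨hS, hD⟩
    refine filterForm_pos ha hγ (hexc S hS) fun h0 => ?_
    rw [Set.mem_ofPred_eq, frobSq_eq_zero.2 h0] at hD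
    exact zero_ne_one hD
  obtain ⟨c, hc, hle⟩ := (h𝒦.prod hsph).exists_forall_le'
    (continuous_filterForm X a γ).continuousOn hpos
  refine ⟨c, hc, fun S hS D => ?_⟩
  rcases (frobSq_nonneg D).eq_or_lt with h0 | h0
  · rw [← h0, mul_zero]
    exact filterForm_nonneg X ha hγ S D
  · set r := Real.sqrt (frobSq D)
    have hr : 0 < r := Real.sqrt_pos.2 h0
    have hr2 : r ^ 2 = frobSq D := Real.sq_sqrt h0.le
    have h1 := hle (S, r⁻¹ • D) ⟨hS, by
      rw [Set.mem_ofPred_eq, frobSq_smul, ← hr2]; field_simp⟩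
    have h2 : filterForm X a γ S (r⁻¹ • D) = (r⁻¹) ^ 2 * filterForm X a γ S D := by
      simp only [filterForm, Matrix.smul_mul, Matrix.mul_smul, ← smul_sub, frobSq_smul]
      ring
    simp only [h2] at h1
    rw [← hr2]
    rw [inv_pow, inv_mul_eq_div, le_div_iff₀ (by positivity)] at h1
    exact h1

/-! ### Majorization of the objective by the graph denoising cost -/

/-- The tangent-line bound for the concave function `u ↦ log (u + δ)`. -/
lemma log_abs_add_le {δ : ℝ} (hδ : 0 < δ) (x y : ℝ) :
    Real.log (|y| + δ) ≤ Real.log (|x| + δ) + 1 / (|x| + δ) * (|y| - |x|) := by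
  have hx : 0 < |x| + δ := by positivity
  have hy : 0 < |y| + δ := by positivity
  have h := Real.log_le_sub_one_of_pos (div_pos hy hx)
  rw [Real.log_div hy.ne' hx.ne'] at h
  have e : (|y| + δ) / (|x| + δ) - 1 = 1 / (|x| + δ) * (|y| - |x|) := by field_simp; ring
  linarith

/-- The graph denoising cost majorizes the objective up to a constant, with equality at the
previous GSO. -/
lemma objective_sub_le_graphCost_sub (X Y : (k : Fin K) → Matrix (Fin N) (Fin (M k)) ℝ)
    (Sbar : Matrix (Fin N) (Fin N) ℝ) (α : Fin K → ℝ) {lam β γ δ₁ δ₂ : ℝ} (hlam : 0 < lam)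
    (hβ : 0 < β) (hδ₁ : 0 < δ₁) (hδ₂ : 0 < δ₂) (H : Fin K → Matrix (Fin N) (Fin N) ℝ)
    (S₀ S : Matrix (Fin N) (Fin N) ℝ) :
    objective X Y Sbar α lam β γ δ₁ δ₂ (H, S) - objective X Y Sbar α lam β γ δ₁ δ₂ (H, S₀)
      ≤ graphCost Sbar lam β γ δ₁ δ₂ S₀ H S - graphCost Sbar lam β γ δ₁ δ₂ S₀ H S₀ := by
  have key : lam * logPenalty δ₁ (S - Sbar) + β * logPenalty δ₂ S
      + ∑ i, ∑ j, (lam * (1 / (|S₀ i j - Sbar i j| + δ₁)) * |S₀ i j - Sbar i j|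
        + β * (1 / (|S₀ i j| + δ₂)) * |S₀ i j|)
      ≤ lam * logPenalty δ₁ (S₀ - Sbar) + β * logPenalty δ₂ S₀
      + ∑ i, ∑ j, (lam * (1 / (|S₀ i j - Sbar i j| + δ₁)) * |S i j - Sbar i j|
        + β * (1 / (|S₀ i j| + δ₂)) * |S i j|) := by
    simp only [logPenalty, Finset.mul_sum, ← Finset.sum_add_distrib, Matrix.sub_apply]
    refine Finset.sum_le_sum fun i _ => Finset.sum_le_sum fun j _ => ?_
    have h1 := mul_le_mul_of_nonneg_left
      (log_abs_add_le hδ₁ (S₀ i j - Sbar i j) (S i j - Sbar i j)) hlam.le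
    have h2 := mul_le_mul_of_nonneg_left (log_abs_add_le hδ₂ (S₀ i j) (S i j)) hβ.le
    linarith
  simp only [objective, graphCost]
  linarith

lemma objective_eq_sum_filterCost (X Y : (k : Fin K) → Matrix (Fin N) (Fin (M k)) ℝ)
    (Sbar : Matrix (Fin N) (Fin N) ℝ) (α : Fin K → ℝ) (lam β γ δ₁ δ₂ : ℝ)
    (z : Vars N K) :
    objective X Y Sbar α lam β γ δ₁ δ₂ z = (∑ k, filterCost (X k) (Y k) (α k) γ z.2 (z.1 k))
      + (lam * logPenalty δ₁ (z.2 - Sbar) + β * logPenalty δ₂ z.2) := by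
  simp only [objective, filterCost, Finset.sum_add_distrib]
  ring

lemma logPenalty_entry_le {δ : ℝ} (hδ : 0 < δ) (Z : Matrix (Fin N) (Fin N) ℝ) (i j : Fin N) :
    Real.log (|Z i j| + δ) - Real.log δ
      ≤ logPenalty δ Z - logPenalty δ (0 : Matrix (Fin N) (Fin N) ℝ) := by
  have h0 : ∀ i j, 0 ≤ Real.log (|Z i j| + δ) - Real.log δ := fun i j =>
    sub_nonneg.2 (Real.log_le_log hδ (by linarith [abs_nonneg (Z i j)]))
  have e : logPenalty δ Z - logPenalty δ (0 : Matrix (Fin N) (Fin N) ℝ)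
      = ∑ i, ∑ j, (Real.log (|Z i j| + δ) - Real.log δ) := by
    simp [logPenalty, Finset.sum_sub_distrib]
  rw [e]
  exact (Finset.single_le_sum (f := fun j => Real.log (|Z i j| + δ) - Real.log δ)
    (fun j _ => h0 i j) (Finset.mem_univ j)).trans
    (Finset.single_le_sum (f := fun i => ∑ j, (Real.log (|Z i j| + δ) - Real.log δ))
      (fun i _ => Finset.sum_nonneg fun j _ => h0 i j) (Finset.mem_univ i))

lemma logPenalty_zero_le {δ : ℝ} (hδ : 0 < δ) (Z : Matrix (Fin N) (Fin N) ℝ) :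
    logPenalty δ (0 : Matrix (Fin N) (Fin N) ℝ) ≤ logPenalty δ Z :=
  Finset.sum_le_sum fun i _ => Finset.sum_le_sum fun j _ =>
    Real.log_le_log (by simpa using hδ) (by simp)

/-! ### Directional derivatives -/

/-- One-sided first-order optimality: a right derivative at a minimum over `[0, 1]`, taken at the
left endpoint, is nonnegative. -/
lemma deriv_nonneg_of_le {χ : ℝ → ℝ} {L : ℝ} (h : HasDerivWithinAt χ L (Set.Ici 0) 0)
    (hχ : ∀ τ ∈ Set.Icc (0 : ℝ) 1, χ 0 ≤ χ τ) : 0 ≤ L := by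
  rw [hasDerivWithinAt_iff_tendsto_slope, Set.Ici_sdiff_left] at h
  refine ge_of_tendsto h ?_
  filter_upwards [Ioc_mem_nhdsGT (zero_lt_one' ℝ)] with τ hτ
  rw [slope_def_field]
  exact div_nonneg (sub_nonneg.2 (hχ τ ⟨hτ.1.le, hτ.2⟩)) (by linarith [hτ.1])

lemma deriv_le_sub_of_convex {ψ : ℝ → ℝ} {L : ℝ} (h : HasDerivWithinAt ψ L (Set.Ici 0) 0)
    (hψ : ConvexOn ℝ Set.univ ψ) : L ≤ ψ 1 - ψ 0 := by
  have h1 := (((hasDerivAt_id' (0 : ℝ)).hasDerivWithinAt (s := Set.Ici 0)).mul_const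
    (ψ 1 - ψ 0)).fun_sub h
  have := deriv_nonneg_of_le h1 (fun τ hτ => by
    have := hψ.2 (Set.mem_univ 0) (Set.mem_univ 1) (sub_nonneg.2 hτ.2) hτ.1 (by ring)
    simp only [smul_eq_mul, mul_zero, mul_one, zero_add] at this
    linarith)
  linarith

/-- The absolute value has one-sided directional derivatives everywhere, also at its kink. -/
lemma exists_hasDerivWithinAt_abs (x d : ℝ) :
    ∃ l : ℝ, HasDerivWithinAt (fun τ : ℝ => |x + τ * d|) l (Set.Ici 0) 0 := by
  have hlin : HasDerivAt (fun τ : ℝ => x + τ * d) d 0 := by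
    simpa using ((hasDerivAt_id' (0 : ℝ)).mul_const d).const_add x
  rcases eq_or_ne x 0 with rfl | hx
  · refine ⟨|d|, ?_⟩
    have h : HasDerivWithinAt (fun τ : ℝ => τ * |d|) |d| (Set.Ici 0) 0 := by
      simpa using ((hasDerivAt_id' (0 : ℝ)).hasDerivWithinAt (s := Set.Ici 0)).mul_const |d|
    refine h.congr (fun τ hτ => ?_) (by simp)
    rw [zero_add, abs_mul, abs_of_nonneg (show 0 ≤ τ from hτ)]
  · have h0 : x + 0 * d ≠ 0 := by simpa using hx
    have h := (hasDerivAt_abs h0).comp (0 : ℝ) hlin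
    exact ⟨_, h.hasDerivWithinAt⟩

/-- The second-order term is there for the commutator `S H - H S`, which is quadratic along a line
on which both factors move. -/
lemma hasDerivAt_frobSq {m n : ℕ} (A B E : Matrix (Fin m) (Fin n) ℝ) :
    HasDerivAt (fun τ : ℝ => frobSq (A + τ • B + τ ^ 2 • E)) (2 * ∑ i, ∑ j, A i j * B i j) 0 := by
  simp only [frobSq, Finset.mul_sum]
  refine HasDerivAt.fun_sum fun i _ => HasDerivAt.fun_sum fun j _ => ?_
  have h1 : HasDerivAt (fun τ : ℝ => A i j + τ * B i j + τ ^ 2 * E i j) (B i j) 0 := by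
    simpa using (((hasDerivAt_id' (0 : ℝ)).mul_const (B i j)).const_add (A i j)).fun_add
      (((hasDerivAt_id' (0 : ℝ)).fun_pow 2).mul_const (E i j))
  have h2 := h1.fun_pow 2
  simp only [Matrix.add_apply, Matrix.smul_apply, smul_eq_mul]
  refine h2.congr_deriv ?_
  simp
  ring

lemma hasDerivAt_frobSq_line {m n : ℕ} (A B : Matrix (Fin m) (Fin n) ℝ) :
    HasDerivAt (fun τ : ℝ => frobSq (A + τ • B)) (2 * ∑ i, ∑ j, A i j * B i j) 0 := by
  simpa using hasDerivAt_frobSq A B 0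

lemma convexOn_sum_univ {ι : Type*} (s : Finset ι) {f : ι → ℝ → ℝ}
    (h : ∀ i ∈ s, ConvexOn ℝ Set.univ (f i)) :
    ConvexOn ℝ Set.univ (fun τ => ∑ i ∈ s, f i τ) := by
  refine ⟨convex_univ, fun x hx y hy a b ha hb hab => ?_⟩
  simp only [Finset.smul_sum, ← Finset.sum_add_distrib]
  exact Finset.sum_le_sum fun i hi => (h i hi).2 hx hy ha hb hab

lemma convexOn_sq_line (a b : ℝ) : ConvexOn ℝ Set.univ (fun τ : ℝ => (a + τ * b) ^ 2) := by
  refine ⟨convex_univ, fun s _ t _ u v hu hv huv => ?_⟩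
  obtain rfl : v = 1 - u := by linarith
  simp only [smul_eq_mul]
  nlinarith [mul_nonneg (mul_nonneg hu hv) (sq_nonneg (s * b - t * b))]

lemma convexOn_abs_line (a b : ℝ) : ConvexOn ℝ Set.univ (fun τ : ℝ => |a + τ * b|) := by
  refine ⟨convex_univ, fun s _ t _ u v hu hv huv => ?_⟩
  simp only [smul_eq_mul]
  have e : a + (u * s + v * t) * b = u * (a + s * b) + v * (a + t * b) := by
    linear_combination (-a) * huv
  rw [e]
  refine (abs_add_le _ _).trans_eq ?_
  rw [abs_mul, abs_mul, abs_of_nonneg hu, abs_of_nonneg hv]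

lemma convexOn_frobSq_line {m n : ℕ} (A B : Matrix (Fin m) (Fin n) ℝ) :
    ConvexOn ℝ Set.univ (fun τ : ℝ => frobSq (A + τ • B)) :=
  convexOn_sum_univ _ fun i _ => convexOn_sum_univ _ fun j _ => convexOn_sq_line (A i j) (B i j)

lemma graphCost_line (Sbar : Matrix (Fin N) (Fin N) ℝ) (lam β γ δ₁ δ₂ : ℝ)
    (S₀ : Matrix (Fin N) (Fin N) ℝ) (H : Fin K → Matrix (Fin N) (Fin N) ℝ)
    (S D : Matrix (Fin N) (Fin N) ℝ) (τ : ℝ) :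
    graphCost Sbar lam β γ δ₁ δ₂ S₀ H (S + τ • D)
      = (∑ i, ∑ j, (lam * (1 / (|S₀ i j - Sbar i j| + δ₁)) * |S i j - Sbar i j + τ * D i j|
        + β * (1 / (|S₀ i j| + δ₂)) * |S i j + τ * D i j|))
        + ∑ k, γ * frobSq (S * H k - H k * S + τ • (D * H k - H k * D)) := by
  unfold graphCost
  congr 1
  · refine Finset.sum_congr rfl fun i _ => Finset.sum_congr rfl fun j _ => ?_
    rw [Matrix.add_apply, Matrix.smul_apply, smul_eq_mul, add_sub_right_comm]
  · refine Finset.sum_congr rfl fun k _ => ?_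
    congr 2
    rw [Matrix.add_mul, Matrix.mul_add, Matrix.smul_mul, Matrix.mul_smul, smul_sub]; abel

lemma convexOn_filterCost_line {m : ℕ} (X Y : Matrix (Fin N) (Fin m) ℝ) {a γ : ℝ}
    (ha : 0 < a) (hγ : 0 < γ) (S H D : Matrix (Fin N) (Fin N) ℝ) :
    ConvexOn ℝ Set.univ (fun τ : ℝ => filterCost X Y a γ S (H + τ • D)) := by
  simp only [filterCost_line]
  exact ((convexOn_frobSq_line _ _).smul ha.le).add ((convexOn_frobSq_line _ _).smul hγ.le)

lemma convexOn_graphCost_line (Sbar : Matrix (Fin N) (Fin N) ℝ) {lam β γ δ₁ δ₂ : ℝ}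
    (hlam : 0 < lam) (hβ : 0 < β) (hγ : 0 < γ) (hδ₁ : 0 < δ₁) (hδ₂ : 0 < δ₂)
    (S₀ : Matrix (Fin N) (Fin N) ℝ) (H : Fin K → Matrix (Fin N) (Fin N) ℝ)
    (S D : Matrix (Fin N) (Fin N) ℝ) :
    ConvexOn ℝ Set.univ (fun τ : ℝ => graphCost Sbar lam β γ δ₁ δ₂ S₀ H (S + τ • D)) := by
  simp only [graphCost_line]
  refine (convexOn_sum_univ _ fun i _ => convexOn_sum_univ _ fun j _ => ?_).add
    (convexOn_sum_univ _ fun k _ => (convexOn_frobSq_line _ _).smul hγ.le)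
  exact ((convexOn_abs_line _ _).smul (by positivity)).add
    ((convexOn_abs_line _ _).smul (by positivity))

/-- The filter costs and the graph denoising cost, each as a function of its own block, have
one-sided directional derivatives whose sum is the directional derivative of the objective: the
weights of the graph cost are the slopes of the logarithms, and the commutator is bilinear. -/
lemma exists_hasDerivWithinAt (X Y : (k : Fin K) → Matrix (Fin N) (Fin (M k)) ℝ)
    (Sbar : Matrix (Fin N) (Fin N) ℝ) (α : Fin K → ℝ) (lam β γ : ℝ) {δ₁ δ₂ : ℝ}
    (hδ₁ : 0 < δ₁) (hδ₂ : 0 < δ₂) (z d : Vars N K) :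
    ∃ (p : Fin K → ℝ) (q : ℝ),
      (∀ k, HasDerivWithinAt
        (fun τ : ℝ => filterCost (X k) (Y k) (α k) γ z.2 (z.1 k + τ • d.1 k))
        (p k) (Set.Ici 0) 0) ∧
      HasDerivWithinAt
        (fun τ : ℝ => graphCost Sbar lam β γ δ₁ δ₂ z.2 z.1 (z.2 + τ • d.2)) q (Set.Ici 0) 0 ∧
      HasDerivWithinAt (fun τ : ℝ => objective X Y Sbar α lam β γ δ₁ δ₂ (z + τ • d))
        ((∑ k, p k) + q) (Set.Ici 0) 0 := by
  obtain ⟨H, S⟩ := z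
  obtain ⟨G, D⟩ := d
  choose l₁ hl₁ using fun i j => exists_hasDerivWithinAt_abs (S i j - Sbar i j) (D i j)
  choose l₂ hl₂ using fun i j => exists_hasDerivWithinAt_abs (S i j) (D i j)
  have hlog : ∀ {δ x e l : ℝ}, 0 < δ →
      HasDerivWithinAt (fun τ : ℝ => |x + τ * e|) l (Set.Ici 0) 0 →
      HasDerivWithinAt (fun τ : ℝ => Real.log (|x + τ * e| + δ)) (1 / (|x| + δ) * l)
        (Set.Ici 0) 0 := by
    intro δ x e l hδ h
    refine ((h.add_const δ).log (by positivity)).congr_deriv ?_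
    rw [zero_mul, add_zero]
    ring
  have hf₁ := fun k => hasDerivAt_frobSq_line (Y k - H k * X k) (-(G k * X k))
  have hf₂ := fun k => hasDerivAt_frobSq_line (S * H k - H k * S) (S * G k - G k * S)
  have hf₃ := fun k => hasDerivAt_frobSq_line (S * H k - H k * S) (D * H k - H k * D)
  have hf₄ := fun k => hasDerivAt_frobSq (S * H k - H k * S)
    ((S * G k - G k * S) + (D * H k - H k * D)) (D * G k - G k * D)
  have e₁ : ∀ (k : Fin K) (τ : ℝ),
      Y k - (H k + τ • G k) * X k = Y k - H k * X k + τ • (-(G k * X k)) := by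
    intro k τ
    rw [Matrix.add_mul, Matrix.smul_mul, smul_neg]; abel
  have e₂ : ∀ (k : Fin K) (τ : ℝ),
      (S + τ • D) * (H k + τ • G k) - (H k + τ • G k) * (S + τ • D)
        = (S * H k - H k * S) + τ • ((S * G k - G k * S) + (D * H k - H k * D))
          + τ ^ 2 • (D * G k - G k * D) := by
    intro k τ
    simp only [Matrix.add_mul, Matrix.mul_add, Matrix.smul_mul, Matrix.mul_smul, smul_sub,
      smul_add, smul_smul, pow_two]
    abel
  have hfilter := fun k => ((hf₁ k).hasDerivWithinAt (s := Set.Ici 0)).const_mul (α k) |>.fun_add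
    ((hf₂ k).hasDerivWithinAt.const_mul γ)
  have hgraph := (HasDerivWithinAt.fun_sum (u := Finset.univ) fun i _ =>
    HasDerivWithinAt.fun_sum (u := Finset.univ) fun j _ =>
      ((hl₁ i j).const_mul (lam * (1 / (|S i j - Sbar i j| + δ₁)))).fun_add
        ((hl₂ i j).const_mul (β * (1 / (|S i j| + δ₂))))).fun_add
    (HasDerivWithinAt.fun_sum (u := Finset.univ) fun k _ =>
      (hf₃ k).hasDerivWithinAt.const_mul γ)
  refine ⟨_, _,
    fun k => (hfilter k).congr (fun τ _ => filterCost_line _ _ _ _ _ _ _ τ)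
      (filterCost_line _ _ _ _ _ _ _ _),
    hgraph.congr (fun τ _ => graphCost_line _ _ _ _ _ _ _ _ _ _ τ)
      (graphCost_line _ _ _ _ _ _ _ _ _ _ _), ?_⟩
  have e₃ : ∀ (τ : ℝ) i j, (S + τ • D - Sbar) i j = S i j - Sbar i j + τ * D i j := by
    intro τ i j
    simp only [Matrix.sub_apply, Matrix.add_apply, Matrix.smul_apply, smul_eq_mul]
    ring
  have hp₁ : HasDerivWithinAt (fun τ : ℝ => logPenalty δ₁ (S + τ • D - Sbar))
      (∑ i, ∑ j, 1 / (|S i j - Sbar i j| + δ₁) * l₁ i j) (Set.Ici 0) 0 := by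
    simp only [logPenalty, e₃]
    exact HasDerivWithinAt.fun_sum fun i _ => HasDerivWithinAt.fun_sum fun j _ =>
      hlog hδ₁ (hl₁ i j)
  have hp₂ : HasDerivWithinAt (fun τ : ℝ => logPenalty δ₂ (S + τ • D))
      (∑ i, ∑ j, 1 / (|S i j| + δ₂) * l₂ i j) (Set.Ici 0) 0 :=
    HasDerivWithinAt.fun_sum fun i _ => HasDerivWithinAt.fun_sum fun j _ =>
      hlog hδ₂ (hl₂ i j)
  have hobj := (((HasDerivWithinAt.fun_sum (u := Finset.univ) fun k _ =>
    (hf₁ k).hasDerivWithinAt.const_mul (α k)).fun_add (hp₁.const_mul lam)).fun_add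
    (hp₂.const_mul β)).fun_add
    (HasDerivWithinAt.fun_sum (u := Finset.univ) fun k _ =>
      (hf₄ k).hasDerivWithinAt.const_mul γ)
  have e₄ : ∀ τ : ℝ, objective X Y Sbar α lam β γ δ₁ δ₂ ((H, S) + τ • (G, D)) = _ := fun τ => by
    simp only [objective, Prod.fst_add, Prod.snd_add, Prod.smul_fst, Prod.smul_snd,
      Pi.add_apply, Pi.smul_apply, e₁, e₂]
    rfl
  refine (hobj.congr (fun τ _ => e₄ τ) (e₄ 0)).congr_deriv ?_
  simp only [Finset.mul_sum, Finset.sum_add_distrib, Matrix.add_apply, mul_add, mul_assoc]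
  ring

/-! ### Stationary points are the block minimizers -/

/-- Fixed points of the alternating algorithm: each filter minimizes its identification cost, and
the GSO is feasible and minimizes the graph denoising cost whose weights it determines itself. -/
def IsBlockMin (X Y : (k : Fin K) → Matrix (Fin N) (Fin (M k)) ℝ)
    (Sbar : Matrix (Fin N) (Fin N) ℝ) (𝒮 : Set (Matrix (Fin N) (Fin N) ℝ)) (α : Fin K → ℝ)
    (lam β γ δ₁ δ₂ : ℝ) (z : Vars N K) : Prop :=
  (∀ k, IsMinOn (filterCost (X k) (Y k) (α k) γ z.2) Set.univ (z.1 k)) ∧ z.2 ∈ 𝒮 ∧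
    IsMinOn (graphCost Sbar lam β γ δ₁ δ₂ z.2 z.1) 𝒮 z.2

/-- A point is stationary exactly if it is a fixed point of the algorithm: at the point the
objective has the same directional derivatives as the sum of the block costs, and those are
convex. -/
lemma isStationaryPoint_iff (X Y : (k : Fin K) → Matrix (Fin N) (Fin (M k)) ℝ)
    (Sbar : Matrix (Fin N) (Fin N) ℝ) {𝒮 : Set (Matrix (Fin N) (Fin N) ℝ)}
    (h𝒮 : Convex ℝ 𝒮) {α : Fin K → ℝ} (hα : ∀ k, 0 < α k) {lam β γ δ₁ δ₂ : ℝ}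
    (hlam : 0 < lam) (hβ : 0 < β) (hγ : 0 < γ) (hδ₁ : 0 < δ₁) (hδ₂ : 0 < δ₂)
    (z : Vars N K) :
    IsStationaryPoint (objective X Y Sbar α lam β γ δ₁ δ₂) {y : Vars N K | y.2 ∈ 𝒮} z ↔
      IsBlockMin X Y Sbar 𝒮 α lam β γ δ₁ δ₂ z := by
  constructor
  · rintro ⟨hz, hstat⟩
    have key : ∀ y : Vars N K, y.2 ∈ 𝒮 →
        0 ≤ (∑ k, (filterCost (X k) (Y k) (α k) γ z.2 (y.1 k)
            - filterCost (X k) (Y k) (α k) γ z.2 (z.1 k)))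
          + (graphCost Sbar lam β γ δ₁ δ₂ z.2 z.1 y.2
            - graphCost Sbar lam β γ δ₁ δ₂ z.2 z.1 z.2) := by
      intro y hy
      obtain ⟨L, hL, hder⟩ := hstat y hy
      obtain ⟨p, q, hp, hq, hpq⟩ :=
        exists_hasDerivWithinAt X Y Sbar α lam β γ hδ₁ hδ₂ z (y - z)
      have hLeq : L = (∑ k, p k) + q :=
        (uniqueDiffWithinAt_Ici (0 : ℝ)).eq_deriv _ hder hpq
      have h1 : ∀ k, p k ≤ filterCost (X k) (Y k) (α k) γ z.2 (y.1 k)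
          - filterCost (X k) (Y k) (α k) γ z.2 (z.1 k) := fun k => by
        simpa using deriv_le_sub_of_convex (hp k) (convexOn_filterCost_line _ _ (hα k) hγ _ _ _)
      have h2 : q ≤ graphCost Sbar lam β γ δ₁ δ₂ z.2 z.1 y.2
          - graphCost Sbar lam β γ δ₁ δ₂ z.2 z.1 z.2 := by
        simpa using deriv_le_sub_of_convex hq
          (convexOn_graphCost_line _ hlam hβ hγ hδ₁ hδ₂ _ _ _ _)
      have h3 := Finset.sum_le_sum fun k (_ : k ∈ Finset.univ) => h1 k
      linarith
    refine ⟨fun k G _ => ?_, hz, fun S hS => ?_⟩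
    · have := key (Function.update z.1 k G, z.2) hz
      rw [Finset.sum_eq_single k (fun j _ hj => by simp [hj]) (by simp)] at this
      simpa using this
    · simpa using key (z.1, S) hS
  · rintro ⟨hH, hz, hS⟩
    refine ⟨hz, fun y hy => ?_⟩
    obtain ⟨p, q, hp, hq, hpq⟩ :=
      exists_hasDerivWithinAt X Y Sbar α lam β γ hδ₁ hδ₂ z (y - z)
    refine ⟨_, add_nonneg (Finset.sum_nonneg fun k _ => ?_) ?_, hpq⟩
    · refine deriv_nonneg_of_le (hp k) fun τ _ => ?_
      simpa using hH k (Set.mem_univ _)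
    · refine deriv_nonneg_of_le hq fun τ hτ => ?_
      simpa using hS (h𝒮.add_smul_sub_mem hz hy hτ)

/-! ### Closedness of the stationary set -/

lemma continuous_filterCost {m : ℕ} (X Y : Matrix (Fin N) (Fin m) ℝ) (a γ : ℝ) :
    Continuous fun p : Matrix (Fin N) (Fin N) ℝ × Matrix (Fin N) (Fin N) ℝ =>
      filterCost X Y a γ p.1 p.2 := by
  have := @continuous_frobSq
  unfold filterCost
  fun_prop

lemma continuous_graphCost (Sbar : Matrix (Fin N) (Fin N) ℝ) (lam β γ : ℝ) {δ₁ δ₂ : ℝ}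
    (hδ₁ : 0 < δ₁) (hδ₂ : 0 < δ₂) :
    Continuous fun p : Vars N K × Matrix (Fin N) (Fin N) ℝ =>
      graphCost Sbar lam β γ δ₁ δ₂ p.1.2 p.1.1 p.2 := by
  have := @continuous_frobSq
  have h₁ : ∀ x : ℝ, |x| + δ₁ ≠ 0 := fun x => by positivity
  have h₂ : ∀ x : ℝ, |x| + δ₂ ≠ 0 := fun x => by positivity
  unfold graphCost
  fun_prop (disch := simp [h₁, h₂])

lemma continuous_objective (X Y : (k : Fin K) → Matrix (Fin N) (Fin (M k)) ℝ)
    (Sbar : Matrix (Fin N) (Fin N) ℝ) (α : Fin K → ℝ) (lam β γ : ℝ) {δ₁ δ₂ : ℝ}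
    (hδ₁ : 0 < δ₁) (hδ₂ : 0 < δ₂) :
    Continuous (objective X Y Sbar α lam β γ δ₁ δ₂) := by
  have := @continuous_frobSq
  have h₁ : ∀ x : ℝ, |x| + δ₁ ≠ 0 := fun x => by positivity
  have h₂ : ∀ x : ℝ, |x| + δ₂ ≠ 0 := fun x => by positivity
  unfold objective logPenalty
  fun_prop (disch := simp [h₁, h₂])

lemma isClosed_isBlockMin (X Y : (k : Fin K) → Matrix (Fin N) (Fin (M k)) ℝ)
    (Sbar : Matrix (Fin N) (Fin N) ℝ) {𝒮 : Set (Matrix (Fin N) (Fin N) ℝ)}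
    (h𝒮 : IsClosed 𝒮) (α : Fin K → ℝ) (lam β γ : ℝ) {δ₁ δ₂ : ℝ}
    (hδ₁ : 0 < δ₁) (hδ₂ : 0 < δ₂) :
    IsClosed {z : Vars N K | IsBlockMin X Y Sbar 𝒮 α lam β γ δ₁ δ₂ z} := by
  have hg := continuous_graphCost (K := K) Sbar lam β γ hδ₁ hδ₂
  simp only [IsBlockMin, isMinOn_iff, Set.ofPred_and, Set.ofPred_forall]
  refine (isClosed_iInter fun k => isClosed_iInter fun G => isClosed_iInter fun _ => ?_).inter
    ((h𝒮.preimage continuous_snd).inter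
      (isClosed_iInter fun S => isClosed_iInter fun _ => ?_))
  · have hf := continuous_filterCost (X k) (Y k) (α k) γ
    have h1 : Continuous fun z : Vars N K => (z.2, z.1 k) := by fun_prop
    have h2 : Continuous fun z : Vars N K => (z.2, G) := by fun_prop
    have h1 := hf.comp h1
    have h2 := hf.comp h2
    exact isClosed_le h1 h2
  · have h1 : Continuous fun z : Vars N K => (z, z.2) := by fun_prop
    have h2 : Continuous fun z : Vars N K => (z, S) := by fun_prop
    have h1 := hg.comp h1
    have h2 := hg.comp h2
    exact isClosed_le h1 h2

lemma continuous_stack : Continuous (stack : Vars N K → _) := by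
  refine (PiLp.continuous_toLp 2 _).comp (continuous_pi ?_)
  rintro (⟨k, i, j⟩ | ⟨i, j⟩)
  · exact (by fun_prop : Continuous fun z : Vars N K => z.1 k i j)
  · exact (by fun_prop : Continuous fun z : Vars N K => z.2 i j)

/-- `stack` is a homeomorphism onto Euclidean space, so it preserves closed sets. -/
lemma isClosed_stack_image {T : Set (Vars N K)} (hT : IsClosed T) : IsClosed (stack '' T) := by
  set u : EuclideanSpace ℝ ((Fin K × Fin N × Fin N) ⊕ (Fin N × Fin N)) → Vars N K :=
    fun v => (fun k => Matrix.of fun i j => v (.inl (k, i, j)),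
      Matrix.of fun i j => v (.inr (i, j)))
    with hu
  have hcont : Continuous u := by
    refine Continuous.prodMk (continuous_pi fun k => ?_) ?_ <;>
    exact continuous_matrix fun i j => by simp only [Matrix.of_apply]; fun_prop
  have e : stack '' T = u ⁻¹' T := by
    refine congrFun (Set.image_eq_preimage_of_inverse (f := stack) (g := u)
      (fun _ => rfl) fun v => ?_) T
    ext (⟨k, i, j⟩ | ⟨i, j⟩) <;> rfl
  rw [e]
  exact hT.preimage hcont

/-! ### Descent and boundedness of a run -/

section Run

variable {X Y : (k : Fin K) → Matrix (Fin N) (Fin (M k)) ℝ} {Sbar : Matrix (Fin N) (Fin N) ℝ}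
  {𝒮 : Set (Matrix (Fin N) (Fin N) ℝ)} {α : Fin K → ℝ} {lam β γ δ₁ δ₂ : ℝ} {z : ℕ → Vars N K}

/-- The quadratic terms of the objective are nonnegative, and `r_{δ₁}` is smallest at zero. -/
lemma le_objective (X Y : (k : Fin K) → Matrix (Fin N) (Fin (M k)) ℝ)
    (Sbar : Matrix (Fin N) (Fin N) ℝ) (hα : ∀ k, 0 < α k) (hlam : 0 < lam) (hγ : 0 < γ)
    (hδ₁ : 0 < δ₁) (z : Vars N K) :
    lam * logPenalty δ₁ (0 : Matrix (Fin N) (Fin N) ℝ) + β * logPenalty δ₂ z.2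
      ≤ objective X Y Sbar α lam β γ δ₁ δ₂ z := by
  have h1 : 0 ≤ ∑ k, filterCost (X k) (Y k) (α k) γ z.2 (z.1 k) :=
    Finset.sum_nonneg fun k _ => add_nonneg (mul_nonneg (hα k).le (frobSq_nonneg _))
      (mul_nonneg hγ.le (frobSq_nonneg _))
  have h2 := mul_le_mul_of_nonneg_left (logPenalty_zero_le hδ₁ (z.2 - Sbar)) hlam.le
  rw [objective_eq_sum_filterCost]
  linarith

/-- Minimizing over the filters does not increase the objective. -/
lemma IsRun.objective_filter_le (hz : IsRun X Y Sbar 𝒮 α lam β γ δ₁ δ₂ z) (t : ℕ) :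
    objective X Y Sbar α lam β γ δ₁ δ₂ ((z (t + 1)).1, (z t).2)
      ≤ objective X Y Sbar α lam β γ δ₁ δ₂ (z t) := by
  rw [objective_eq_sum_filterCost, objective_eq_sum_filterCost]
  gcongr with k
  exact hz.filter_step t k (Set.mem_univ _)

/-- The objective decreases from the first feasible iterate on; the starting point may lie
outside `𝒮`. -/
lemma IsRun.antitone_objective (hz : IsRun X Y Sbar 𝒮 α lam β γ δ₁ δ₂ z) (hlam : 0 < lam)
    (hβ : 0 < β) (hδ₁ : 0 < δ₁) (hδ₂ : 0 < δ₂) :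
    Antitone fun t => objective X Y Sbar α lam β γ δ₁ δ₂ (z (t + 1)) := by
  refine antitone_nat_of_succ_le fun t => ?_
  have h1 := objective_sub_le_graphCost_sub X Y Sbar α (γ := γ) hlam hβ hδ₁ hδ₂ (z (t + 2)).1
    (z (t + 1)).2 (z (t + 2)).2
  have h2 : graphCost Sbar lam β γ δ₁ δ₂ (z (t + 1)).2 (z (t + 2)).1 (z (t + 2)).2
      ≤ graphCost Sbar lam β γ δ₁ δ₂ (z (t + 1)).2 (z (t + 2)).1 (z (t + 1)).2 :=
    hz.graph_step (t + 1) (hz.graph_mem t)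
  have h3 := hz.objective_filter_le (t + 1)
  change objective X Y Sbar α lam β γ δ₁ δ₂ ((z (t + 2)).1, (z (t + 2)).2) ≤ _
  change _ ≤ objective X Y Sbar α lam β γ δ₁ δ₂ (z (t + 1)) at h3
  linarith

lemma IsRun.exists_tendsto_objective (hz : IsRun X Y Sbar 𝒮 α lam β γ δ₁ δ₂ z)
    (hα : ∀ k, 0 < α k) (hlam : 0 < lam)
    (hβ : 0 < β) (hγ : 0 < γ) (hδ₁ : 0 < δ₁) (hδ₂ : 0 < δ₂) :
    ∃ ℓ, Tendsto (fun t => objective X Y Sbar α lam β γ δ₁ δ₂ (z t)) atTop (𝓝 ℓ) := by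
  refine ⟨_, (tendsto_add_atTop_iff_nat 1).1
    (tendsto_atTop_ciInf (hz.antitone_objective hlam hβ hδ₁ hδ₂)
      ⟨lam * logPenalty δ₁ (0 : Matrix (Fin N) (Fin N) ℝ)
        + β * logPenalty δ₂ (0 : Matrix (Fin N) (Fin N) ℝ), ?_⟩)⟩
  rintro _ ⟨t, rfl⟩
  refine le_trans ?_ (le_objective X Y Sbar hα hlam hγ hδ₁ _)
  gcongr
  exact logPenalty_zero_le hδ₂ _

/-- The penalty `r_{δ₂}` is coercive, so descent keeps the GSOs in a box. -/
lemma IsRun.exists_graph_mem_box (hz : IsRun X Y Sbar 𝒮 α lam β γ δ₁ δ₂ z)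
    (hα : ∀ k, 0 < α k) (hlam : 0 < lam)
    (hβ : 0 < β) (hγ : 0 < γ) (hδ₁ : 0 < δ₁) (hδ₂ : 0 < δ₂) :
    ∃ R, ∀ t, (z (t + 1)).2 ∈ box N R := by
  set m := lam * logPenalty δ₁ (0 : Matrix (Fin N) (Fin N) ℝ)
    + β * logPenalty δ₂ (0 : Matrix (Fin N) (Fin N) ℝ) with hm
  set F := objective X Y Sbar α lam β γ δ₁ δ₂ with hF
  refine ⟨Real.exp ((F (z 1) - m) / β + Real.log δ₂), fun t i j => ?_⟩
  have h1 : F (z (t + 1)) ≤ F (z 1) := hz.antitone_objective hlam hβ hδ₁ hδ₂ (Nat.zero_le t)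
  have h2 := le_objective (β := β) (δ₂ := δ₂) X Y Sbar hα hlam hγ hδ₁ (z (t + 1))
  have h3 := mul_le_mul_of_nonneg_left (logPenalty_entry_le hδ₂ (z (t + 1)).2 i j) hβ.le
  have h4 : Real.log (|(z (t + 1)).2 i j| + δ₂) ≤ (F (z 1) - m) / β + Real.log δ₂ := by
    rw [← sub_le_iff_le_add, le_div_iff₀ hβ]
    linarith
  have h5 := (Real.log_le_iff_le_exp (by positivity)).1 h4
  linarith

/-- Excitation on the compact closure of the GSOs bounds the filters as well: compare the
minimizer with the zero filter. -/
lemma IsRun.exists_compact (hz : IsRun X Y Sbar 𝒮 α lam β γ δ₁ δ₂ z)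
    (hα : ∀ k, 0 < α k) (hlam : 0 < lam)
    (hβ : 0 < β) (hγ : 0 < γ) (hδ₁ : 0 < δ₁) (hδ₂ : 0 < δ₂)
    (hexc : ∀ k, ∀ S ∈ closure (Set.range fun t => (z t).2), ExcitesAllFrequencies S (X k)) :
    ∃ B : Set (Vars N K), IsCompact B ∧ ∀ t, z t ∈ B := by
  obtain ⟨R, hR⟩ := hz.exists_graph_mem_box hα hlam hβ hγ hδ₁ hδ₂
  have hcpt : IsCompact (closure (Set.range fun t => (z t).2)) := by
    refine ((isCompact_box N R).insert (z 0).2).closure_of_subset ?_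
    rintro _ ⟨t, rfl⟩
    cases t with
    | zero => exact Or.inl rfl
    | succ t => exact Or.inr (hR t)
  choose c hc hcoer using fun k => exists_coercive (hα k) hγ hcpt (hexc k)
  have hH : ∀ t k, (z (t + 1)).1 k ∈ box N (Real.sqrt (α k * frobSq (Y k) / c k)) := by
    intro t k
    refine mem_box_of_frobSq_le ((le_div_iff₀ (hc k)).2 ?_)
    have h1 := filterCost_eq_of_isMinOn (hz.filter_step t k) 0
    have h2 := hcoer k (z t).2 (subset_closure ⟨t, rfl⟩) (0 - (z (t + 1)).1 k)
    have h3 : frobSq (0 - (z (t + 1)).1 k) = frobSq ((z (t + 1)).1 k) := by simp [frobSq]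
    have h4 : filterCost (X k) (Y k) (α k) γ (z t).2 0 = α k * frobSq (Y k) := by
      simp [filterCost, frobSq]
    have h5 : 0 ≤ filterCost (X k) (Y k) (α k) γ (z t).2 ((z (t + 1)).1 k) :=
      add_nonneg (mul_nonneg (hα k).le (frobSq_nonneg _)) (mul_nonneg hγ.le (frobSq_nonneg _))
    rw [h3] at h2
    linarith
  refine ⟨insert (z 0) ((Set.univ.pi fun k =>
    box N (Real.sqrt (α k * frobSq (Y k) / c k))) ×ˢ box N R),
    ((isCompact_univ_pi fun k => isCompact_box N _).prod (isCompact_box N R)).insert _, ?_⟩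
  intro t
  cases t with
  | zero => exact Or.inl rfl
  | succ t => exact Or.inr ⟨fun k _ => hH t k, hR t⟩

/-! ### Cluster points of a run -/

/-- If consecutive iterates converge along a subsequence, the limit is a fixed point. Both limits
have the same objective value, so neither half step from the first limit decreases the
objective. -/
lemma IsRun.isBlockMin_of_tendsto (hz : IsRun X Y Sbar 𝒮 α lam β γ δ₁ δ₂ z)
    (h𝒮 : IsClosed 𝒮) (hα : ∀ k, 0 < α k) (hlam : 0 < lam)
    (hβ : 0 < β) (hγ : 0 < γ) (hδ₁ : 0 < δ₁) (hδ₂ : 0 < δ₂)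
    (hexc : ∀ k, ∀ S ∈ closure (Set.range fun t => (z t).2), ExcitesAllFrequencies S (X k))
    {ns : ℕ → ℕ} (hns : Tendsto ns atTop atTop) {p p' : Vars N K}
    (hp : Tendsto (fun n => z (ns n)) atTop (𝓝 p))
    (hp' : Tendsto (fun n => z (ns n + 1)) atTop (𝓝 p')) :
    IsBlockMin X Y Sbar 𝒮 α lam β γ δ₁ δ₂ p := by
  obtain ⟨H, S⟩ := p
  obtain ⟨H', S'⟩ := p'
  set F := objective X Y Sbar α lam β γ δ₁ δ₂ with hF
  have hFcont : Continuous F := continuous_objective X Y Sbar α lam β γ hδ₁ hδ₂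
  have hpS : Tendsto (fun n => (z (ns n)).2) atTop (𝓝 S) := (continuous_snd.tendsto _).comp hp
  have hpS' : Tendsto (fun n => (z (ns n + 1)).2) atTop (𝓝 S') :=
    (continuous_snd.tendsto _).comp hp'
  have hpH' : Tendsto (fun n => (z (ns n + 1)).1) atTop (𝓝 H') :=
    (continuous_fst.tendsto _).comp hp'
  -- The starting point may be infeasible, so feasibility of the limit comes from the later iterates.
  have hS : S ∈ 𝒮 := by
    refine h𝒮.mem_of_tendsto hpS ?_
    filter_upwards [hns.eventually_ge_atTop 1] with n hn
    obtain ⟨t, ht⟩ := Nat.exists_eq_add_of_le' hn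
    rw [ht]
    exact hz.graph_mem t
  have hvalue : F (H, S) = F (H', S') := by
    obtain ⟨ℓ, hℓ⟩ := hz.exists_tendsto_objective hα hlam hβ hγ hδ₁ hδ₂
    have h1 := tendsto_nhds_unique ((hFcont.tendsto _).comp hp) (hℓ.comp hns)
    have h2 := tendsto_nhds_unique ((hFcont.tendsto _).comp hp')
      (hℓ.comp ((tendsto_add_atTop_nat 1).comp hns))
    exact h1.trans h2.symm
  have hfilter : ∀ k, IsMinOn (filterCost (X k) (Y k) (α k) γ S) Set.univ (H' k) := by
    intro k G _
    have hc := continuous_filterCost (X k) (Y k) (α k) γ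
    exact le_of_tendsto_of_tendsto'
      ((hc.tendsto (S, H' k)).comp (hpS.prodMk_nhds ((continuous_apply k).tendsto _ |>.comp hpH')))
      ((hc.tendsto (S, G)).comp (hpS.prodMk_nhds tendsto_const_nhds))
      fun n => hz.filter_step (ns n) k (Set.mem_univ G)
  have hgraph : IsMinOn (graphCost Sbar lam β γ δ₁ δ₂ S H') 𝒮 S' := by
    intro T hT
    have hc := continuous_graphCost (K := K) Sbar lam β γ hδ₁ hδ₂
    have hw := hpH'.prodMk_nhds hpS
    exact le_of_tendsto_of_tendsto'
      ((hc.tendsto ((H', S), S')).comp (hw.prodMk_nhds hpS'))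
      ((hc.tendsto ((H', S), T)).comp (hw.prodMk_nhds tendsto_const_nhds))
      fun n => hz.graph_step (ns n) hT
  -- `F (H', S') ≤ F (H', S) ≤ F (H, S)`, and the outer values agree.
  have hmaj := objective_sub_le_graphCost_sub X Y Sbar α (γ := γ) hlam hβ hδ₁ hδ₂ H' S S'
  have hgS : graphCost Sbar lam β γ δ₁ δ₂ S H' S' ≤ graphCost Sbar lam β γ δ₁ δ₂ S H' S :=
    hgraph hS
  -- The excess of `H` over the minimizing filters `H'` is a sum of nonnegative quadratic forms.
  have hexcess : F (H, S) = F (H', S)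
      + ∑ k, filterForm (X k) (α k) γ S (H k - H' k) := by
    simp only [hF, objective_eq_sum_filterCost]
    rw [Finset.sum_congr rfl fun k _ => filterCost_eq_of_isMinOn (hfilter k) (H k),
      Finset.sum_add_distrib]
    ring
  have hform : ∀ k ∈ Finset.univ, 0 ≤ filterForm (X k) (α k) γ S (H k - H' k) :=
    fun k _ => filterForm_nonneg _ (hα k) hγ _ _
  have hsum := Finset.sum_nonneg hform
  change F (H', S') - F (H', S) ≤ _ at hmaj
  have hzero := (Finset.sum_eq_zero_iff_of_nonneg hform).1 (by linarith)
  have hSmem : S ∈ closure (Set.range fun t => (z t).2) :=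
    mem_closure_of_tendsto hpS (Eventually.of_forall fun n => ⟨ns n, rfl⟩)
  have hHH' : H = H' := by
    funext k
    by_contra hne
    exact (filterForm_pos (hα k) hγ (hexc k S hSmem) (sub_ne_zero.2 hne)).ne'
      (hzero k (Finset.mem_univ k))
  subst hHH'
  -- Majorization turns `F (H, S') = F (H, S)` into equality of the graph costs at `S` and `S'`.
  refine ⟨hfilter, hS, fun T hT => ?_⟩
  have := hgraph hT
  change graphCost Sbar lam β γ δ₁ δ₂ S H S ≤ graphCost Sbar lam β γ δ₁ δ₂ S H T
  change graphCost Sbar lam β γ δ₁ δ₂ S H S' ≤ graphCost Sbar lam β γ δ₁ δ₂ S H T at this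
  linarith

end Run

end JointGF

end

theorem corollary2 {N K : ℕ} {M : Fin K → ℕ}
    (X Y : (k : Fin K) → Matrix (Fin N) (Fin (M k)) ℝ) (Sbar : Matrix (Fin N) (Fin N) ℝ)
    (𝒮 : Set (Matrix (Fin N) (Fin N) ℝ)) (h𝒮_closed : IsClosed 𝒮) (h𝒮_convex : Convex ℝ 𝒮)
    (α : Fin K → ℝ) (hα : ∀ k, 0 < α k)
    (lam β γ δ₁ δ₂ : ℝ) (hlam : 0 < lam) (hβ : 0 < β) (hγ : 0 < γ) (hδ₁ : 0 < δ₁) (hδ₂ : 0 < δ₂)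
    (z : ℕ → JointGF.Vars N K)
    (hz : JointGF.IsRun X Y Sbar 𝒮 α lam β γ δ₁ δ₂ z)
    (hexc : ∀ k, ∀ S ∈ closure (Set.range fun t => (z t).2),
      JointGF.ExcitesAllFrequencies S (X k)) :
    (∀ t, ∃ p ∈ JointGF.stationarySet X Y Sbar 𝒮 α lam β γ δ₁ δ₂,
      dist (JointGF.stack (z t)) p =
        Metric.infDist (JointGF.stack (z t))
          (JointGF.stationarySet X Y Sbar 𝒮 α lam β γ δ₁ δ₂)) ∧
    Tendsto (fun t => Metric.infDist (JointGF.stack (z t))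
      (JointGF.stationarySet X Y Sbar 𝒮 α lam β γ δ₁ δ₂)) atTop (𝓝 0) := by
  set Z := JointGF.stationarySet X Y Sbar 𝒮 α lam β γ δ₁ δ₂ with hZ
  have hZeq : Z = JointGF.stack ''
      {z : JointGF.Vars N K | JointGF.IsBlockMin X Y Sbar 𝒮 α lam β γ δ₁ δ₂ z} := by
    simp only [hZ, JointGF.stationarySet,
      JointGF.isStationaryPoint_iff X Y Sbar h𝒮_convex hα hlam hβ hγ hδ₁ hδ₂]
  have hclosed : IsClosed Z := by
    rw [hZeq]
    exact JointGF.isClosed_stack_image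
      (JointGF.isClosed_isBlockMin X Y Sbar h𝒮_closed α lam β γ hδ₁ hδ₂)
  obtain ⟨B, hB, hzB⟩ := hz.exists_compact hα hlam hβ hγ hδ₁ hδ₂ hexc
  have hcluster : ∀ ns : ℕ → ℕ, Tendsto ns atTop atTop →
      ∃ (ms : ℕ → ℕ) (p : JointGF.Vars N K), JointGF.stack p ∈ Z ∧
        Tendsto (fun n => z (ns (ms n))) atTop (𝓝 p) := by
    intro ns hns
    have : FirstCountableTopology (Matrix (Fin N) (Fin N) ℝ) :=
      inferInstanceAs (FirstCountableTopology (Fin N → Fin N → ℝ))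
    -- Extract the limits of the iterate and of its successor together.
    obtain ⟨⟨p, p'⟩, -, ms, hms, hlim⟩ := (hB.prod hB).tendsto_subseq
      (x := fun n => (z (ns n), z (ns n + 1))) fun n => ⟨hzB _, hzB _⟩
    have hp : Tendsto (fun n => z (ns (ms n))) atTop (𝓝 p) :=
      (continuous_fst.tendsto _).comp hlim
    have hp' : Tendsto (fun n => z (ns (ms n) + 1)) atTop (𝓝 p') :=
      (continuous_snd.tendsto _).comp hlim
    refine ⟨ms, p, ?_, hp⟩
    rw [hZeq]
    exact ⟨p, hz.isBlockMin_of_tendsto h𝒮_closed hα hlam hβ hγ hδ₁ hδ₂ hexc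
      (hns.comp hms.tendsto_atTop) hp hp', rfl⟩
  have hne : Z.Nonempty := by
    obtain ⟨-, p, hp, -⟩ := hcluster id tendsto_id
    exact ⟨_, hp⟩
  refine ⟨fun t => ?_, tendsto_of_subseq_tendsto fun ns hns => ?_⟩
  · obtain ⟨p, hp, hdist⟩ := hclosed.exists_infDist_eq_dist hne (JointGF.stack (z t))
    exact ⟨p, hp, hdist.symm⟩
  · obtain ⟨ms, p, hp, hlim⟩ := hcluster ns hns
    refine ⟨ms, ?_⟩
    have h := (((Metric.continuous_infDist_pt Z).comp JointGF.continuous_stack).tendsto p).comp hlim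
    simpa only [Function.comp_def, Metric.infDist_zero_of_mem hp] using h
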